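/- Let $p$ be an odd prime, put $c_p=\frac{p-2}{p-1}$ and $\Lambda=\mathbb{Z}_p[[w]]$, and let $\mathbf{A}^0=\mathbb{Z}_p\langle z\rangle$ be the ring of power series over $\mathbb{Z}_p$ whose coefficients tend to $0$. Let $\mathbf{D}^0\hat\otimes\Lambda$ be the module of $\Lambda$-valued distributions on $\mathbf{A}^0$, i.e. of ($\mathbb{Z}_p$-linear, hence continuous) maps $\mu:\mathbf{A}^0\to\Lambda$. For an integer $M\ge 0$ let $\widetilde{\mathrm{Fil}}^M$ be the submodule of those $\mu$ such that for every $j\ge 0$ all coefficients of the power series $\mu(z^j)\in\Lambda$ have $p$-adic valuation at least $M-jc_p$, and set $\widetilde{\mathcal F}(M)=(\mathbf{D}^0\hat\otimes\Lambda)/\widetilde{\mathrm{Fil}}^M$. For $\bar\mu\in\widetilde{\mathcal F}(M)$ the moment $\bar\mu(z^j)$ is a well-defined element of $\Lambda/p^{\max(\lceil M-jc_p\rceil,0)}\Lambda$. Let $\Delta=\begin{pmatrix}1&1\\0&1\end{pmatrix}-1$ be the difference operator, $(\mu|\Delta)(f)=\mu(f(z+1))-\mu(f(z))$, which preserves $\widetilde{\mathrm{Fil}}^M$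 and so acts on $\widetilde{\mathcal F}(M)$. Let $b_n$ be the Bernoulli numbers, with $b_1=-\tfrac12$. Let $M\ge 1$ be an integer, let $\bar\nu\in\widetilde{\mathcal F}(M)$ have total measure zero (i.e. $\bar\nu(z^0)=0$ in $\Lambda/p^M\Lambda$), and set $m=\left\lfloor\frac{\log(M/c_p)}{\log p}\right\rfloor$. Then: 1. For all integers $0\le r<M/c_p-1$ and $1\le j\le r+1$, one has $\frac{p^m}{j}\binom{r}{j-1}b_{r+1-j}\in\mathbb{Z}_p$. 2. There is a unique $\bar\mu\in\widetilde{\mathcal F}(M-1)$ such that $$\bar\mu(z^r)=\sum_{j=1}^{r+1}\frac{p^m\,\bar\nu(z^j)}{j}\binom{r}{j-1}b_{r+1-j}\qquad\text{for all integers } 0\le r<M/c_p-1,$$ where the equality holds in $\Lambda/p^{\max(\lceil M-1-rc_p\rceil,0)}\Lambda$ and the right-hand side may be computed from any lift of $\bar\nu$ to $\mathbf{D}^0\hat\otimes\Lambda$ (it does not depend on the lift). 3. This $\bar\mu$ satisfies $\bar\mu|\Delta=p^m\bar\nu$ in $\widetilde{\mathcal F}(M-1)$, where $\bar\nu$ on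 the right is projected to $\widetilde{\mathcal F}(M-1)$. -/

import Mathlib

open Filter Topology PowerSeries

noncomputable section

namespace FamDist

variable (p : ℕ) [Fact p.Prime]

/-- The constant `c_p = (p - 2) / (p - 1)`. -/
def cp (p : ℕ) : ℝ := ((p : ℝ) - 2) / ((p : ℝ) - 1)

/-- The ring `Λ = ℤ_p[[w]]`. -/
abbrev Lam : Type := ℤ_[p]⟦X⟧

/-- The unit ball `A⁰ = ℤ_p⟨z⟩` of the Tate algebra `ℚ_p⟨z⟩`: power series over `ℤ_p` in `z` whose
coefficients tend to zero. -/
def tate : Submodule ℤ_[p] ℤ_[p]⟦X⟧ where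
  carrier := {f | IsRestricted 1 f}
  add_mem' := isRestricted.add 1
  zero_mem' := isRestricted_zero 1
  smul_mem' a f hf := by
    have h := isRestricted.mul 1 (isRestricted_C 1 a) hf
    rwa [← smul_eq_C_mul] at h

lemma mem_tate {f : ℤ_[p]⟦X⟧} : f ∈ tate p ↔ Tendsto (fun n => coeff n f) atTop (𝓝 0) := by
  change IsRestricted 1 f ↔ _
  rw [isRestricted_iff', tendsto_zero_iff_norm_tendsto_zero (f := fun n => coeff n f)]
  simp only [one_pow, mul_one]

/-- The monomial `z ^ j` of `A⁰`. -/
def zpow (j : ℕ) : tate p :=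
  ⟨monomial j 1, isRestricted_monomial 1 j 1⟩

lemma summable_translate (f : tate p) (n : ℕ) :
    Summable fun k : ℕ => (k.choose n : ℤ_[p]) * coeff k (f : ℤ_[p]⟦X⟧) := by
  apply NonarchimedeanAddGroup.summable_of_tendsto_cofinite_zero
  rw [Nat.cofinite_eq_atTop, tendsto_zero_iff_norm_tendsto_zero]
  refine squeeze_zero (fun _ => norm_nonneg _) (fun k => ?_)
    (tendsto_zero_iff_norm_tendsto_zero.1 ((mem_tate p).1 f.2))
  rw [norm_mul]
  exact mul_le_of_le_one_left (norm_nonneg _) (PadicInt.norm_le_one _)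

/-- The translation `f(z) ↦ f(z + 1)` of `A⁰`: the coefficient of `z ^ n` in
`∑ k, a_k (z + 1) ^ k` is `∑ k, binom(k, n) a_k`. -/
def translate : tate p →ₗ[ℤ_[p]] tate p where
  toFun f := ⟨PowerSeries.mk fun n => ∑' k : ℕ, (k.choose n : ℤ_[p]) * coeff k (f : ℤ_[p]⟦X⟧), by
    rw [mem_tate, Metric.tendsto_atTop]
    intro ε hε
    obtain ⟨N, hN⟩ := Metric.tendsto_atTop.1 ((mem_tate p).1 f.2) (ε / 2) (half_pos hε)
    refine ⟨N, fun n hn => ?_⟩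
    rw [dist_zero_right, coeff_mk]
    refine lt_of_le_of_lt (IsUltrametricDist.norm_tsum_le_of_forall_le_of_nonneg
      (half_pos hε).le fun k => ?_) (half_lt_self hε)
    rcases lt_or_ge k n with h | h
    · rw [Nat.choose_eq_zero_of_lt h, Nat.cast_zero, zero_mul, norm_zero]
      exact (half_pos hε).le
    · rw [norm_mul]
      refine (mul_le_of_le_one_left (norm_nonneg _) (PadicInt.norm_le_one _)).trans ?_
      simpa using (hN k (hn.trans h)).le⟩
  map_add' f g := by
    ext n
    simp only [coeff_mk, Submodule.coe_add, map_add, mul_add]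
    exact (summable_translate p f n).tsum_add (summable_translate p g n)
  map_smul' a f := by
    ext n
    simp only [coeff_mk, Submodule.coe_smul, map_smul, smul_eq_mul, RingHom.id_apply]
    rw [← (summable_translate p f n).tsum_mul_left]
    exact tsum_congr fun k => by ring

lemma translate_zpow (j : ℕ) :
    translate p (zpow p j) = ∑ i ∈ Finset.range (j + 1), (j.choose i : ℤ_[p]) • zpow p i := by
  apply Subtype.ext
  ext n
  change coeff n (PowerSeries.mk fun n => ∑' k : ℕ,
    (k.choose n : ℤ_[p]) * coeff k (zpow p j : ℤ_[p]⟦X⟧)) = _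
  rw [coeff_mk, tsum_eq_single j]
  · simp only [zpow, AddSubmonoidClass.coe_finsetSum, Submodule.coe_smul, map_sum, map_smul,
      coeff_monomial, smul_eq_mul, mul_ite, mul_one, mul_zero, if_true]
    rw [Finset.sum_ite_eq]
    split_ifs with h
    · rfl
    · rw [Finset.mem_range, not_lt] at h
      simp [Nat.choose_eq_zero_of_lt (Nat.lt_of_succ_le h)]
  · intro k hk
    simp [zpow, coeff_monomial, hk]

/-- The module `D⁰ ⊗̂ Λ` of families of integral distributions (`D⁰` the profinite unit ball of the
dual of the Tate algebra): the `Λ`-valued distributions on `A⁰`. Continuity is automatic, a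
`ℤ_p`-linear map sends `p ^ n A⁰` into `p ^ n Λ`; such a map is the same as its sequence of
moments, which may be any sequence of elements of `Λ`. -/
abbrev Dist : Type := tate p →ₗ[ℤ_[p]] Lam p

/-- The `j`-th moment `μ(z ^ j)`. -/
def moment (j : ℕ) : Dist p →ₗ[Lam p] Lam p where
  toFun μ := μ (zpow p j)
  map_add' _ _ := rfl
  map_smul' _ _ := rfl

/-- The action of the matrix `(1, 1; 0, 1)`: `(μ | γ)(f) = μ(f(z + 1))`. (In every weight component
the automorphy factor of this matrix is `1`.) -/
def actUnipotent : Dist p →ₗ[Lam p] Dist p where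
  toFun μ := μ.comp (translate p)
  map_add' _ _ := rfl
  map_smul' _ _ := rfl

/-- The difference operator `Δ = (1, 1; 0, 1) - 1`. -/
def diffOp : Dist p →ₗ[Lam p] Dist p := actUnipotent p - LinearMap.id

/-- The elements of `Λ` all of whose coefficients have `p`-adic valuation at least `s`, that is,
have absolute value at most `p ^ (-s)`. -/
def ordGe (s : ℝ) : Submodule (Lam p) (Lam p) where
  carrier := {x | ∀ n, ‖coeff n x‖ ≤ (p : ℝ) ^ (-s)}
  add_mem' {x y} hx hy n := by
    rw [map_add]
    exact (PadicInt.nonarchimedean _ _).trans (max_le (hx n) (hy n))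
  zero_mem' n := by
    rw [map_zero, norm_zero]
    exact Real.rpow_nonneg (Nat.cast_nonneg p) _
  smul_mem' a x hx n := by
    rw [smul_eq_mul, coeff_mul]
    refine IsUltrametricDist.norm_sum_le_of_forall_le_of_nonneg
      (Real.rpow_nonneg (Nat.cast_nonneg p) _) fun i _ => ?_
    rw [norm_mul]
    exact (mul_le_of_le_one_left (norm_nonneg _) (PadicInt.norm_le_one _)).trans (hx i.2)

lemma ordGe_anti {s t : ℝ} (h : s ≤ t) : ordGe p t ≤ ordGe p s := fun _ hx n =>
  (hx n).trans (Real.rpow_le_rpow_of_exponent_le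
    (by exact_mod_cast (Fact.out : p.Prime).one_lt.le) (neg_le_neg h))

lemma cp_nonneg : 0 ≤ cp p := by
  have h : (2 : ℝ) ≤ p := by exact_mod_cast (Fact.out : p.Prime).two_le
  exact div_nonneg (by linarith) (by linarith)

/-- The `M`-th step of the filtration of `D⁰ ⊗̂ Λ`: the `j`-th moment has valuation at least
`M - j c_p`, for all `j`. -/
def Fil (M : ℕ) : Submodule (Lam p) (Dist p) :=
  ⨅ j : ℕ, (ordGe p ((M : ℝ) - j * cp p)).comap (moment p j)

lemma mem_Fil {M : ℕ} {μ : Dist p} :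
    μ ∈ Fil p M ↔ ∀ j : ℕ, moment p j μ ∈ ordGe p ((M : ℝ) - j * cp p) := by
  simp [Fil]

lemma Fil_anti {M N : ℕ} (h : M ≤ N) : Fil p N ≤ Fil p M := fun _ hμ =>
  (mem_Fil p).2 fun j => ordGe_anti p
    (sub_le_sub_right (Nat.cast_le.2 h) _) ((mem_Fil p).1 hμ j)

lemma moment_actUnipotent (j : ℕ) (μ : Dist p) :
    moment p j (actUnipotent p μ) =
      ∑ i ∈ Finset.range (j + 1), (j.choose i : Lam p) • moment p i μ := by
  change μ (translate p (zpow p j)) = _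
  rw [translate_zpow, map_sum]
  refine Finset.sum_congr rfl fun i _ => ?_
  rw [Nat.cast_smul_eq_nsmul, Nat.cast_smul_eq_nsmul, map_nsmul]
  rfl

lemma Fil_le_comap_diffOp (M : ℕ) : Fil p M ≤ (Fil p M).comap (diffOp p) := by
  intro μ hμ
  refine Submodule.sub_mem _ ((mem_Fil p).2 fun j => ?_) hμ
  rw [moment_actUnipotent]
  refine Submodule.sum_mem _ fun i hi => Submodule.smul_mem _ _ (ordGe_anti p ?_
    ((mem_Fil p).1 hμ i))
  have hij : (i : ℝ) ≤ j := by exact_mod_cast Nat.lt_succ_iff.1 (Finset.mem_range.1 hi)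
  exact sub_le_sub_left (mul_le_mul_of_nonneg_right hij (cp_nonneg p)) _

/-- The `M`-th approximation module, the quotient of `D⁰ ⊗̂ Λ` by the `M`-th step of the
filtration. -/
abbrev Approx (M : ℕ) : Type := Dist p ⧸ Fil p M

/-- The natural map from the `N`-th to the `M`-th approximation module, for `M ≤ N`. -/
def Approx.proj {M N : ℕ} (h : M ≤ N) : Approx p N →ₗ[Lam p] Approx p M :=
  Submodule.factor (Fil_anti p h)

/-- The difference operator on the `M`-th approximation module. -/
def Approx.diffOp (M : ℕ) : Approx p M →ₗ[Lam p] Approx p M :=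
  (Fil p M).mapQ (Fil p M) (FamDist.diffOp p) (Fil_le_comap_diffOp p M)

/-- The precision `max(⌈M - j c_p⌉, 0)` to which the `j`-th moment of an element of the `M`-th
approximation module is defined. -/
def prec (M j : ℕ) : ℕ := ⌈(M : ℝ) - j * cp p⌉₊

/-- The ideal `p ^ k Λ`. -/
abbrev pIdeal (k : ℕ) : Ideal (Lam p) := Ideal.span {(p : Lam p) ^ k}

lemma ordGe_le_pIdeal (s : ℝ) : ordGe p s ≤ pIdeal p ⌈s⌉₊ := by
  intro x hx
  have hdvd : ∀ n, (p : ℤ_[p]) ^ ⌈s⌉₊ ∣ coeff n x := by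
    intro n
    rw [← Ideal.mem_span_singleton]
    by_cases h0 : coeff n x = 0
    · rw [h0]; exact Ideal.zero_mem _
    rw [PadicInt.mem_span_pow_iff_le_valuation _ h0, Nat.ceil_le]
    have h := hx n
    rw [PadicInt.norm_eq_zpow_neg_valuation h0, ← Real.rpow_intCast] at h
    have hp1 : (1 : ℝ) < p := by exact_mod_cast (Fact.out : p.Prime).one_lt
    rw [Real.rpow_le_rpow_left_iff hp1] at h
    push_cast at h
    linarith
  choose y hy using hdvd
  refine Ideal.mem_span_singleton.2 ⟨PowerSeries.mk y, ?_⟩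
  ext n
  have hC : ((p : Lam p) ^ ⌈s⌉₊) = C ((p : ℤ_[p]) ^ ⌈s⌉₊) := by simp
  rw [hC, coeff_C_mul, coeff_mk, hy]

/-- The `j`-th moment of an element of the `M`-th approximation module, an element of
`Λ / p ^ ⌈M - j c_p⌉`. -/
def Approx.moment (M j : ℕ) : Approx p M →ₗ[Lam p] Lam p ⧸ pIdeal p (prec p M j) :=
  (Fil p M).mapQ (pIdeal p (prec p M j)) (FamDist.moment p j)
    fun _ hμ => ordGe_le_pIdeal p _ ((mem_Fil p).1 hμ j)

/-- The exponent `⌊log(M / c_p) / log p⌋`. -/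
def denomExp (M : ℕ) : ℕ := ⌊Real.log ((M : ℝ) / cp p) / Real.log p⌋₊

end FamDist

end

namespace FamDist

variable {p : ℕ} [Fact p.Prime]

open Finset

/-! On moments, `Δ` is the triangular system `(μ|Δ)(z^j) = ∑_{i<j} binom(j,i) μ(z^i)`. The Bernoulli
recursion `∑_{k<n} binom(n,k) b_k = [n = 1]` inverts it, so the formula solves the equation exactly
for each lift (`sum_choose_smul_formula`), apart from `j = 0`, where total measure zero is needed.

The factor `p^m` clears denominators (`norm_bernoulli_coeff_le_one`): every `r` in range has `r + 1
< p^(m+1)`, and by von Staudt–Clausen a Bernoulli number costs at most one further `p`.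

One step of the filtration is lost because `μ(z^r)` involves `ν(z^(r+1))`, and `c_p < 1`. For `r ≥
M/c_p - 1` level `M - 1` imposes no condition on moments, which gives uniqueness. -/

/-! ### Integrality of the coefficients -/

lemma norm_natCast_inv_le_of_prime {q : ℕ} (hq : q.Prime) (C : ℝ) (hC : 1 ≤ C)
    (h : q = p → (p : ℝ) ≤ C) : ‖(q : ℚ_[p])⁻¹‖ ≤ C := by
  rw [norm_inv]
  rcases eq_or_ne q p with rfl | hne
  · rw [Padic.norm_p, inv_inv]
    exact h rfl
  · rw [Padic.norm_natCast_eq_one_iff.2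
      ((Nat.coprime_primes (Fact.out : p.Prime) hq).2 hne.symm), inv_one]
    exact hC

/-- Von Staudt–Clausen in two uses: `C = p` always works, and `C = 1` works unless `n ≠ 0` and `p -
1 ∣ n`. The value `b_1 = -1/2` is integral because `p` is odd. -/
lemma norm_bernoulli_le (hp : p ≠ 2) (n : ℕ) (C : ℝ) (hC : 1 ≤ C)
    (h : n ≠ 0 → p - 1 ∣ n → (p : ℝ) ≤ C) : ‖((bernoulli n : ℚ) : ℚ_[p])‖ ≤ C := by
  rcases Nat.even_or_odd' n with ⟨k, rfl | rfl⟩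
  · rcases Nat.eq_zero_or_pos k with rfl | hk
    · simpa using hC
    obtain ⟨z, hz⟩ := Bernoulli.vonStaudt_clausen k
    rw [eq_comm, ← eq_sub_iff_add_eq] at hz
    rw [hz]
    push_cast
    rw [sub_eq_add_neg]
    refine (IsUltrametricDist.norm_add_le_max _ _).trans (max_le
      ((Padic.norm_int_le_one z).trans hC) ?_)
    rw [norm_neg]
    refine IsUltrametricDist.norm_sum_le_of_forall_le_of_nonneg (by linarith) fun q hq => ?_
    rw [mem_filter] at hq
    rw [one_div]
    refine norm_natCast_inv_le_of_prime hq.2.1 C hC fun hqp => h (by omega) ?_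
    rw [← hqp]
    exact hq.2.2
  · rcases Nat.eq_zero_or_pos k with rfl | hk
    · have h2 : ‖(2 : ℚ_[p])‖ = 1 := by
        have := Padic.norm_natCast_eq_one_iff (p := p) (n := 2)
        rw [Nat.coprime_primes Fact.out Nat.prime_two] at this
        exact_mod_cast this.2 hp
      simpa [h2] using hC
    · rw [bernoulli_eq_zero_of_odd ⟨k, rfl⟩ (by omega)]
      simpa using zero_le_one.trans hC

lemma norm_prime_pow_div_le_one {k j : ℕ} (h : ¬ p ^ (k + 1) ∣ j) :
    ‖(p : ℚ_[p]) ^ k / (j : ℚ_[p])‖ ≤ 1 := by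
  have h1 : ¬ ‖(j : ℚ_[p])‖ ≤ (p : ℝ) ^ (-((k + 1 : ℕ) : ℤ)) := by
    have := Padic.norm_int_le_pow_iff_dvd (p := p) (j : ℤ) (k + 1)
    rw [Int.cast_natCast] at this
    rw [this]
    exact_mod_cast h
  have h2 : (p : ℝ) ^ (-(k : ℤ)) ≤ ‖(j : ℚ_[p])‖ := by
    rw [Padic.norm_le_pow_iff_norm_lt_pow_add_one, not_lt] at h1
    rwa [show -((k + 1 : ℕ) : ℤ) + 1 = -(k : ℤ) by push_cast; ring] at h1
  have hp0 : (0 : ℝ) < (p : ℝ) ^ (-(k : ℤ)) :=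
    zpow_pos (by exact_mod_cast (Fact.out : p.Prime).pos) _
  rw [norm_div, Padic.norm_p_pow]
  exact (div_le_one (hp0.trans_le h2)).2 h2

/-- When `p^m ∤ j`, the quotient `p^m / j` still contains a factor `p`, which absorbs the
denominator of `y`. -/
lemma norm_prime_pow_div_mul_le_one {m j : ℕ} (hj : ¬ p ^ m ∣ j) {x y : ℚ_[p]} (hx : ‖x‖ ≤ 1)
    (hy : ‖y‖ ≤ p) : ‖(p : ℚ_[p]) ^ m / (j : ℚ_[p]) * x * y‖ ≤ 1 := by
  obtain ⟨k, rfl⟩ := Nat.exists_eq_succ_of_ne_zero (n := m) (by rintro rfl; simp at hj)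
  have hp0 : (0 : ℝ) < p := by exact_mod_cast (Fact.out : p.Prime).pos
  have hpy : ‖(p : ℚ_[p]) * y‖ ≤ 1 := by
    rw [norm_mul, Padic.norm_p]
    calc (p : ℝ)⁻¹ * ‖y‖ ≤ (p : ℝ)⁻¹ * p := by gcongr
      _ = 1 := inv_mul_cancel₀ hp0.ne'
  have : (p : ℚ_[p]) ^ (k + 1) / (j : ℚ_[p]) * x * y
      = ((p : ℚ_[p]) ^ k / (j : ℚ_[p])) * x * (p * y) := by ring
  rw [Nat.succ_eq_add_one, this, norm_mul, norm_mul]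
  exact mul_le_one₀ (mul_le_one₀ (norm_prime_pow_div_le_one hj) (norm_nonneg _) hx)
    (norm_nonneg _) hpy

lemma norm_bernoulli_coeff_le_one (hp : p ≠ 2) {m r j : ℕ} (hr : r + 1 < p ^ (m + 1))
    (hj : 1 ≤ j) (hjr : j ≤ r + 1) :
    ‖(p : ℚ_[p]) ^ m / (j : ℚ_[p]) * (r.choose (j - 1) : ℚ_[p])
      * ((bernoulli (r + 1 - j) : ℚ) : ℚ_[p])‖ ≤ 1 := by
  have hprime : p.Prime := Fact.out
  have hp1 : (1 : ℝ) ≤ p := by exact_mod_cast hprime.one_lt.le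
  have hchoose (a b : ℕ) : ‖(a.choose b : ℚ_[p])‖ ≤ 1 := IsUltrametricDist.norm_natCast_le_one ℚ_[p] _
  have hb := norm_bernoulli_le hp (r + 1 - j) p hp1 fun _ _ => le_rfl
  by_cases hdj : p ^ m ∣ j
  swap
  · exact norm_prime_pow_div_mul_le_one hdj (hchoose _ _) hb
  by_cases hdr : p ^ m ∣ r + 1
  swap
  · have hj0 : (j : ℚ_[p]) ≠ 0 := by exact_mod_cast (by omega : j ≠ 0)
    have hr0 : ((r + 1 : ℕ) : ℚ_[p]) ≠ 0 := by exact_mod_cast r.succ_ne_zero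
    -- Trading the denominator `j` for `r + 1`, which `p^m` does not divide, reduces to the previous
    -- case.
    have key : (p : ℚ_[p]) ^ m / (j : ℚ_[p]) * (r.choose (j - 1) : ℚ_[p])
        = (p : ℚ_[p]) ^ m / ((r + 1 : ℕ) : ℚ_[p]) * ((r + 1).choose j : ℚ_[p]) := by
      have h := Nat.add_one_mul_choose_eq r (j - 1)
      rw [Nat.sub_add_cancel hj] at h
      have h' : ((r + 1 : ℕ) : ℚ_[p]) * (r.choose (j - 1) : ℚ_[p])
          = ((r + 1).choose j : ℚ_[p]) * (j : ℚ_[p]) := by exact_mod_cast h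
      rw [div_mul_eq_mul_div, div_mul_eq_mul_div, div_eq_div_iff hj0 hr0]
      linear_combination (p : ℚ_[p]) ^ m * h'
    rw [key]
    exact norm_prime_pow_div_mul_le_one hdr (hchoose _ _) hb
  have hnj : ¬ p ^ (m + 1) ∣ j := fun h => by
    have := Nat.le_of_dvd (by omega) h
    omega
  -- Now `p^m / j` has no `p` to spare, but `r + 1 - j = p^m (b - a)` with `0 < a` and `b < p`.
  -- Since `p - 1` is prime to `p^m`, it could only divide a nonzero such number by dividing `b - a
  -- < p - 1`.
  have hb1 : ‖((bernoulli (r + 1 - j) : ℚ) : ℚ_[p])‖ ≤ 1 := by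
    refine norm_bernoulli_le hp _ 1 le_rfl fun h0 hdvd => ?_
    obtain ⟨a, rfl⟩ := hdj
    obtain ⟨b, hb'⟩ := hdr
    rw [hb'] at hr hdvd h0
    rw [← Nat.mul_sub] at hdvd h0
    have hpos : 0 < p ^ m := pow_pos hprime.pos m
    have hbp : b < p := by
      rw [pow_succ] at hr
      exact Nat.lt_of_mul_lt_mul_left hr
    have ha : 0 < a := Nat.pos_of_mul_pos_left (by omega : 0 < p ^ m * a)
    have hcop : Nat.Coprime (p - 1) (p ^ m) := by
      refine Nat.Coprime.pow_right m ?_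
      exact (Nat.coprime_self_sub_left hprime.one_lt.le).2 (Nat.coprime_one_left p)
    have hd : p - 1 ∣ b - a := hcop.dvd_of_dvd_mul_left hdvd
    have hba : 0 < b - a := Nat.pos_of_ne_zero fun h => h0 (by rw [h, mul_zero])
    have := Nat.le_of_dvd hba hd
    omega
  rw [norm_mul, norm_mul]
  exact mul_le_one₀ (mul_le_one₀ (norm_prime_pow_div_le_one hnj) (norm_nonneg _) (hchoose _ _))
    (norm_nonneg _) hb1

/-! ### Inverting the difference operator over the rationals -/

/-- With `a = l - 1`, `binom(j,i) binom(i,a) = binom(j,a) binom(j-a,i-a)` turns the sum into the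
Bernoulli recursion for `n = j - a`. -/
lemma sum_choose_mul_bernoulli_coeff {l j : ℕ} (hl : 1 ≤ l) (hlj : l ≤ j) :
    ∑ i ∈ Ico (l - 1) j, (j.choose i : ℚ) * ((l : ℚ)⁻¹ * (i.choose (l - 1) : ℚ)
      * bernoulli (i + 1 - l)) = if l = j then 1 else 0 := by
  obtain ⟨a, rfl⟩ := Nat.exists_eq_add_of_le' hl
  have h : ∀ i ∈ Ico a j, (j.choose i : ℚ) * (((a + 1 : ℕ) : ℚ)⁻¹ * (i.choose a : ℚ)
      * bernoulli (i + 1 - (a + 1))) = ((a + 1 : ℕ) : ℚ)⁻¹ * (j.choose a : ℚ) *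
        (((j - a).choose (i - a) : ℚ) * bernoulli (i - a)) := by
    intro i hi
    rw [mem_Ico] at hi
    have h := Nat.choose_mul (n := j) hi.1
    have h' : (j.choose i : ℚ) * (i.choose a : ℚ)
        = (j.choose a : ℚ) * ((j - a).choose (i - a) : ℚ) := by exact_mod_cast h
    rw [Nat.add_sub_add_right]
    linear_combination ((a + 1 : ℕ) : ℚ)⁻¹ * bernoulli (i - a) * h'
  rw [Nat.add_sub_cancel, sum_congr rfl h, ← mul_sum, sum_Ico_eq_sum_range]
  simp only [Nat.add_sub_cancel_left]
  rw [sum_bernoulli]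
  by_cases hj : a + 1 = j
  · subst hj
    rw [if_pos (by omega), if_pos rfl, Nat.choose_succ_self_right, mul_one]
    exact inv_mul_cancel₀ (by exact_mod_cast a.succ_ne_zero)
  · rw [if_neg (by omega), if_neg hj, mul_zero]

/-! ### Precision and moments -/

lemma cp_pos (hp : p ≠ 2) : 0 < cp p := by
  have h : (3 : ℝ) ≤ p := by
    have := (Fact.out : p.Prime).two_le
    exact_mod_cast (by omega : 3 ≤ p)
  exact div_pos (by linarith) (by linarith)

lemma cp_lt_one : cp p < 1 := by
  have h : (2 : ℝ) ≤ p := by exact_mod_cast (Fact.out : p.Prime).two_le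
  rw [cp, div_lt_one (by linarith)]
  linarith

lemma lt_pow_denomExp_succ {M r : ℕ} (hr : (r : ℝ) < (M : ℝ) / cp p - 1) :
    r + 1 < p ^ (denomExp p M + 1) := by
  have hp1 : (1 : ℝ) < p := by exact_mod_cast (Fact.out : p.Prime).one_lt
  have hx : (r : ℝ) + 1 < (M : ℝ) / cp p := by linarith
  have hx0 : 0 < (M : ℝ) / cp p := lt_trans (by positivity) hx
  have h := Nat.lt_floor_add_one (Real.log ((M : ℝ) / cp p) / Real.log p)
  rw [div_lt_iff₀ (Real.log_pos hp1)] at h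
  have h2 : (M : ℝ) / cp p < (p : ℝ) ^ (denomExp p M + 1) := by
    rw [← Real.log_lt_log_iff hx0 (by positivity), Real.log_pow]
    simpa [denomExp] using h
  exact_mod_cast hx.trans h2

lemma mem_ordGe_of_nonpos {s : ℝ} (hs : s ≤ 0) (x : Lam p) : x ∈ ordGe p s := fun n =>
  (PadicInt.norm_le_one _).trans (Real.one_le_rpow
    (by exact_mod_cast (Fact.out : p.Prime).one_lt.le) (by linarith))

lemma ordGe_eq_pIdeal (s : ℝ) : ordGe p s = pIdeal p ⌈s⌉₊ := by
  refine le_antisymm (ordGe_le_pIdeal p s) ?_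
  rw [Ideal.span_singleton_le_iff_mem]
  refine ordGe_anti p (Nat.le_ceil s) fun n => ?_
  have hC : ((p : Lam p) ^ ⌈s⌉₊) = C ((p : ℤ_[p]) ^ ⌈s⌉₊) := by simp
  rw [hC, coeff_C]
  split_ifs
  · rw [PadicInt.norm_p_pow, ← Real.rpow_intCast]
    push_cast
    rfl
  · rw [norm_zero]
    exact Real.rpow_nonneg (Nat.cast_nonneg p) _

lemma smul_mem_ordGe {s : ℝ} (a : ℤ_[p]) {x : Lam p} (hx : x ∈ ordGe p s) :
    a • x ∈ ordGe p s := by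
  rw [smul_eq_C_mul]
  exact Submodule.smul_mem _ (C a) hx

lemma mk_eq_mk_iff {M j : ℕ} (x y : Lam p) :
    (Submodule.Quotient.mk x : Lam p ⧸ pIdeal p (prec p M j)) = Submodule.Quotient.mk y ↔
      x - y ∈ ordGe p ((M : ℝ) - j * cp p) := by
  rw [ordGe_eq_pIdeal]
  exact Submodule.Quotient.eq _

/-- There is a distribution with finitely many prescribed moments. -/
lemma exists_moment_eq (R : ℕ) (x : ℕ → Lam p) :
    ∃ μ : Dist p, ∀ r < R, moment p r μ = x r := by
  refine ⟨∑ i ∈ range R, LinearMap.smulRight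
    ((coeff i : ℤ_[p]⟦X⟧ →ₗ[ℤ_[p]] ℤ_[p]) ∘ₗ (tate p).subtype) (x i), fun r hr => ?_⟩
  change (∑ i ∈ range R, LinearMap.smulRight
    ((coeff i : ℤ_[p]⟦X⟧ →ₗ[ℤ_[p]] ℤ_[p]) ∘ₗ (tate p).subtype) (x i)) (zpow p r) = x r
  rw [LinearMap.sum_apply, sum_eq_single r]
  · simp [zpow]
  · intro i _ hi
    simp [zpow, coeff_monomial, hi]
  · intro h
    exact absurd (mem_range.2 hr) h

lemma moment_diffOp (j : ℕ) (μ : Dist p) :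
    moment p j (diffOp p μ) = ∑ i ∈ range j, (j.choose i : Lam p) • moment p i μ := by
  rw [diffOp, LinearMap.sub_apply, map_sub, moment_actUnipotent, sum_range_succ, Nat.choose_self,
    Nat.cast_one, one_smul, LinearMap.id_apply, add_sub_cancel_right]

/-- Membership in a step of the filtration only involves the moments of low degree. -/
lemma mem_Fil_pred (hp : p ≠ 2) {M : ℕ} (hM : 1 ≤ M) {μ : Dist p}
    (h : ∀ j : ℕ, (j : ℝ) < (M : ℝ) / cp p - 1 →
      moment p j μ ∈ ordGe p (((M - 1 : ℕ) : ℝ) - j * cp p)) : μ ∈ Fil p (M - 1) := by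
  refine (mem_Fil p).2 fun j => ?_
  by_cases hj : (j : ℝ) < (M : ℝ) / cp p - 1
  · exact h j hj
  · refine mem_ordGe_of_nonpos ?_ _
    have hc := cp_pos hp
    rw [not_lt, sub_le_iff_le_add, div_le_iff₀ hc] at hj
    have := cp_lt_one (p := p)
    rw [Nat.cast_sub hM, Nat.cast_one]
    nlinarith

/-- The coefficients of the formula for the solution of the difference equation, with the value
zero where they are not integral. -/
noncomputable def bernoulliCoeff (p : ℕ) [Fact p.Prime] (M r j : ℕ) : ℤ_[p] :=
  Function.extend ((↑) : ℤ_[p] → ℚ_[p]) id 0 ((p : ℚ_[p]) ^ denomExp p M / (j : ℚ_[p])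
    * (r.choose (j - 1) : ℚ_[p]) * ((bernoulli (r + 1 - j) : ℚ) : ℚ_[p]))

lemma coe_bernoulliCoeff (hp : p ≠ 2) {M r j : ℕ} (hr : (r : ℝ) < (M : ℝ) / cp p - 1)
    (hj : 1 ≤ j) (hjr : j ≤ r + 1) :
    (bernoulliCoeff p M r j : ℚ_[p]) = (p : ℚ_[p]) ^ denomExp p M / (j : ℚ_[p])
      * (r.choose (j - 1) : ℚ_[p]) * ((bernoulli (r + 1 - j) : ℚ) : ℚ_[p]) := by
  have hinj : Function.Injective ((↑) : ℤ_[p] → ℚ_[p]) := fun _ _ => PadicInt.ext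
  exact congrArg ((↑) : ℤ_[p] → ℚ_[p]) (hinj.extend_apply id (0 : ℚ_[p] → ℤ_[p])
    ⟨_, norm_bernoulli_coeff_le_one hp (lt_pow_denomExp_succ hr) hj hjr⟩)

lemma sum_choose_mul_bernoulliCoeff {M l j : ℕ} {c : ℕ → ℕ → ℤ_[p]}
    (hc : ∀ r j : ℕ, (r : ℝ) < (M : ℝ) / cp p - 1 → 1 ≤ j → j ≤ r + 1 →
      (c r j : ℚ_[p]) = (p : ℚ_[p]) ^ denomExp p M / (j : ℚ_[p])
        * (r.choose (j - 1) : ℚ_[p]) * ((bernoulli (r + 1 - j) : ℚ) : ℚ_[p]))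
    (hj : (j : ℝ) < (M : ℝ) / cp p - 1) (hl : 1 ≤ l) (hlj : l ≤ j) :
    ∑ i ∈ Ico (l - 1) j, (j.choose i : ℤ_[p]) * c i l
      = if l = j then (p : ℤ_[p]) ^ denomExp p M else 0 := by
  apply PadicInt.ext
  have h := congrArg (fun x : ℚ => (p : ℚ_[p]) ^ denomExp p M * (x : ℚ_[p]))
    (sum_choose_mul_bernoulli_coeff hl hlj)
  have hR : ((if l = j then (p : ℤ_[p]) ^ denomExp p M else 0 : ℤ_[p]) : ℚ_[p])
      = (p : ℚ_[p]) ^ denomExp p M * (((if l = j then 1 else 0 : ℚ)) : ℚ_[p]) := by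
    split_ifs <;> simp
  refine Eq.trans ?_ (h.trans hR.symm)
  rw [PadicInt.coe_sum, Rat.cast_sum, mul_sum]
  refine sum_congr rfl fun i hi => ?_
  rw [mem_Ico] at hi
  have hij : (i : ℝ) < j := by exact_mod_cast hi.2
  rw [PadicInt.coe_mul, PadicInt.coe_natCast, hc i l (hij.trans hj) hl (by omega)]
  push_cast
  ring

lemma sum_choose_smul_formula {M j : ℕ} {c : ℕ → ℕ → ℤ_[p]}
    (hc : ∀ r j : ℕ, (r : ℝ) < (M : ℝ) / cp p - 1 → 1 ≤ j → j ≤ r + 1 →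
      (c r j : ℚ_[p]) = (p : ℚ_[p]) ^ denomExp p M / (j : ℚ_[p])
        * (r.choose (j - 1) : ℚ_[p]) * ((bernoulli (r + 1 - j) : ℚ) : ℚ_[p]))
    (hj : (j : ℝ) < (M : ℝ) / cp p - 1) (hj1 : 1 ≤ j) (x : ℕ → Lam p) :
    ∑ i ∈ range j, (j.choose i : Lam p) • ∑ l ∈ Icc 1 (i + 1), c i l • x l
      = (p : Lam p) ^ denomExp p M • x j := by
  have hsmul (i : ℕ) (y : Lam p) : (j.choose i : Lam p) • y = (j.choose i : ℤ_[p]) • y := by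
    rw [Nat.cast_smul_eq_nsmul, Nat.cast_smul_eq_nsmul]
  simp only [hsmul, smul_sum, smul_smul]
  rw [sum_comm' (t' := Icc 1 j) (s' := fun l => Ico (l - 1) j)
    (fun i l => by simp only [mem_range, mem_Icc, mem_Ico]; omega)]
  have : ∀ l ∈ Icc 1 j, ∑ i ∈ Ico (l - 1) j, ((j.choose i : ℤ_[p]) * c i l) • x l
      = if l = j then (p : Lam p) ^ denomExp p M • x j else 0 := by
    intro l hl
    rw [mem_Icc] at hl
    rw [← sum_smul, sum_choose_mul_bernoulliCoeff hc hj hl.1 hl.2]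
    split_ifs with h
    · rw [h, smul_eq_C_mul, smul_eq_mul]
      simp
    · rw [zero_smul]
  rw [sum_congr rfl this, sum_ite_eq', if_pos (mem_Icc.2 ⟨hj1, le_rfl⟩)]

/-- The formula only depends on the image in the approximation module. -/
lemma formula_sub_mem {M r : ℕ} (hM : 1 ≤ M) (c : ℕ → ℕ → ℤ_[p]) {ν ν' : Dist p}
    (h : ν - ν' ∈ Fil p M) :
    ∑ j ∈ Icc 1 (r + 1), c r j • moment p j ν - ∑ j ∈ Icc 1 (r + 1), c r j • moment p j ν'
      ∈ ordGe p (((M - 1 : ℕ) : ℝ) - r * cp p) := by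
  rw [← sum_sub_distrib]
  refine Submodule.sum_mem _ fun j hj => ?_
  rw [← smul_sub, ← map_sub]
  refine smul_mem_ordGe _ (ordGe_anti p ?_ ((mem_Fil p).1 h j))
  have hjr : (j : ℝ) ≤ r + 1 := by exact_mod_cast (mem_Icc.1 hj).2
  have h0 := cp_nonneg p
  have h1 := cp_lt_one (p := p)
  -- The worst index is `j = r + 1`, where `M - (r+1) c_p ≥ M - 1 - r c_p`.
  rw [Nat.cast_sub hM, Nat.cast_one]
  nlinarith

end FamDist

theorem mainTheorem10 (p : ℕ) [Fact p.Prime] (hp : p ≠ 2) (M : ℕ) (hM : 1 ≤ M)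
    (νbar : FamDist.Approx p M) (hν : FamDist.Approx.moment p M 0 νbar = 0) :
    -- the coefficients of the formula are `p`-integral
    ∃ c : ℕ → ℕ → ℤ_[p],
      (∀ r j : ℕ, (r : ℝ) < (M : ℝ) / FamDist.cp p - 1 → 1 ≤ j → j ≤ r + 1 →
        (c r j : ℚ_[p]) = (p : ℚ_[p]) ^ FamDist.denomExp p M / (j : ℚ_[p])
          * (r.choose (j - 1) : ℚ_[p]) * ((bernoulli (r + 1 - j) : ℚ) : ℚ_[p])) ∧
      -- the formula, evaluated on any lift of `νbar`, defines a unique element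
      (∃! μbar : FamDist.Approx p (M - 1),
        ∀ ν : FamDist.Dist p, Submodule.Quotient.mk ν = νbar →
          ∀ r : ℕ, (r : ℝ) < (M : ℝ) / FamDist.cp p - 1 →
            FamDist.Approx.moment p (M - 1) r μbar =
              Submodule.Quotient.mk (∑ j ∈ Finset.Icc 1 (r + 1), c r j • FamDist.moment p j ν)) ∧
      -- and that element solves the difference equation
      ∀ μbar : FamDist.Approx p (M - 1),
        (∀ ν : FamDist.Dist p, Submodule.Quotient.mk ν = νbar →
          ∀ r : ℕ, (r : ℝ) < (M : ℝ) / FamDist.cp p - 1 →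
            FamDist.Approx.moment p (M - 1) r μbar =
              Submodule.Quotient.mk (∑ j ∈ Finset.Icc 1 (r + 1), c r j • FamDist.moment p j ν)) →
        FamDist.Approx.diffOp p (M - 1) μbar =
          (p : FamDist.Lam p) ^ FamDist.denomExp p M •
            FamDist.Approx.proj p (Nat.sub_le M 1) νbar := by
  obtain ⟨ν₀, rfl⟩ := Submodule.Quotient.mk_surjective _ νbar
  have hν₀ : FamDist.moment p 0 ν₀ ∈ FamDist.ordGe p ((M : ℝ) - (0 : ℕ) * FamDist.cp p) := by
    rw [FamDist.ordGe_eq_pIdeal]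
    exact (Submodule.Quotient.mk_eq_zero _).1 hν
  have hc := fun (r j : ℕ) (hr : (r : ℝ) < (M : ℝ) / FamDist.cp p - 1) (hj : 1 ≤ j) (hjr : j ≤ r + 1) =>
    FamDist.coe_bernoulliCoeff hp hr hj hjr
  refine ⟨FamDist.bernoulliCoeff p M, hc, ?_, ?_⟩
  -- The cutoff covers all `r < M/c_p - 1`; higher moments do not affect the class.
  · obtain ⟨μ, hμ⟩ := FamDist.exists_moment_eq ⌈(M : ℝ) / FamDist.cp p⌉₊ fun r =>
      ∑ j ∈ Finset.Icc 1 (r + 1), FamDist.bernoulliCoeff p M r j • FamDist.moment p j ν₀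
    refine ⟨Submodule.Quotient.mk μ, fun ν hν' r hr => ?_, fun μbar' hμ' => ?_⟩
    · refine (FamDist.mk_eq_mk_iff _ _).2 ?_
      rw [hμ r (Nat.lt_ceil.2 (by linarith))]
      exact FamDist.formula_sub_mem hM _ ((Submodule.Quotient.eq _).1 hν'.symm)
    · obtain ⟨μ', rfl⟩ := Submodule.Quotient.mk_surjective _ μbar'
      refine (Submodule.Quotient.eq _).2 (FamDist.mem_Fil_pred hp hM fun r hr => ?_)
      rw [map_sub, hμ r (Nat.lt_ceil.2 (by linarith))]
      exact (FamDist.mk_eq_mk_iff _ _).1 (hμ' ν₀ rfl r hr)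
  · intro μbar hμ
    obtain ⟨μ, rfl⟩ := Submodule.Quotient.mk_surjective _ μbar
    refine (Submodule.Quotient.eq _).2 (FamDist.mem_Fil_pred hp hM fun j hj => ?_)
    rw [map_sub, map_smul, FamDist.moment_diffOp, LinearMap.id_apply]
    -- `Δ` kills the zeroth moment, so this case rests on the total measure of `ν` vanishing.
    rcases Nat.eq_zero_or_pos j with rfl | hj1
    · rw [Finset.sum_range_zero, zero_sub]
      refine Submodule.neg_mem _ (Submodule.smul_mem _ _ (FamDist.ordGe_anti p ?_ hν₀))
      exact sub_le_sub_right (Nat.cast_le.2 (Nat.sub_le M 1)) _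
    -- It remains to bound the errors of `μ(z^i)` for `i < j`, which are known to higher precision
    -- than degree `j` requires.
    · rw [← FamDist.sum_choose_smul_formula hc hj hj1 fun l => FamDist.moment p l ν₀,
        ← Finset.sum_sub_distrib]
      refine Submodule.sum_mem _ fun i hi => ?_
      have hij : (i : ℝ) < j := by exact_mod_cast Finset.mem_range.1 hi
      rw [← smul_sub]
      refine Submodule.smul_mem _ _ (FamDist.ordGe_anti p ?_
        ((FamDist.mk_eq_mk_iff _ _).1 (hμ ν₀ rfl i (hij.trans hj))))
      exact sub_le_sub_left (mul_le_mul_of_nonneg_right hij.le (FamDist.cp_nonneg p)) _
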